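/- Let $n\ge 0$ and let $S_n$ be the group of permutations of $\{1,\dots,n\}$, with simple transpositions $s_i=(i\;\,i+1)$. On $\mathbb{Z}[x_1,\dots,x_n;y_1,\dots,y_n]$ let $$\partial_iP=\frac{P-s_iP}{x_i-x_{i+1}}\qquad(1\le i<n),$$ where $s_iP$ is obtained from $P$ by exchanging $x_i$ and $x_{i+1}$. The double Schubert polynomials $\mathfrak{S}_w(x;y)$, $w\in S_n$, are defined by $$\mathfrak{S}_{w_0}(x;y)=\prod_{i+j\le n}(x_i-y_j)$$ for the longest permutation $w_0=[n,n-1,\dots,1]$, and $\mathfrak{S}_{w}=\partial_i\,\mathfrak{S}_{ws_i}$ whenever $w(i)<w(i+1)$ (the result does not depend on the choice of $i$). The single Schubert polynomial is $\mathfrak{S}_w(x)=\mathfrak{S}_w(x;0)$. A permutation $w\in S_n$ is called dominant if there is a partition $\lambda=(\lambda_1\ge\lambda_2\ge\cdots\ge\lambda_n\ge 0)$ with $\lambda_i+i\le n$ for all $i$ such that, for every $i$, $w(i)$ is the $(\lambda_i+1)$-st smallest element of $\{1,\dots,n\}\setminus\{w(1),\dots,w(i-1)\}$. Proposition. For every $w\in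 S_n$: 1. $w$ is dominant if and only if its diagram $D(w)=\{(i,j) : j<w(i),\ i<w^{-1}(j)\}$ is a Young diagram, i.e. $(i,j)\in D(w)$ implies $(i',j')\in D(w)$ for all $1\le i'\le i$, $1\le j'\le j$. 2. $w$ is dominant if and only if the single Schubert polynomial $\mathfrak{S}_w(x)$ is a monomial $x_1^{m_1}\cdots x_n^{m_n}$ (with coefficient $1$). 3. $w$ is dominant if and only if the double Schubert polynomial $\mathfrak{S}_w(x;y)$ is a product of binomials $x_i-y_j$ with $1\le i,j\le n$ (the empty product and repeated factors are allowed). -/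

import Mathlib

namespace Schubert

open MvPolynomial

/-! ### Divided differences -/

/-- The difference of `P` and the polynomial obtained from it by exchanging the variables
`X a` and `X b` is divisible by `X a - X b`. -/
theorem exists_divDiff {σ : Type*} [DecidableEq σ] (a b : σ) (P : MvPolynomial σ ℤ) :
    ∃ Q : MvPolynomial σ ℤ, P - rename (Equiv.swap a b) P = (X a - X b) * Q := by
  induction P using MvPolynomial.induction_on with
  | C c => exact ⟨0, by simp⟩
  | add p q hp hq =>
    obtain ⟨p', hp'⟩ := hp
    obtain ⟨q', hq'⟩ := hq
    refine ⟨p' + q', ?_⟩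
    rw [map_add, mul_add, ← hp', ← hq']
    ring
  | mul_X p k hp =>
    obtain ⟨p', hp'⟩ := hp
    have hk : ∃ r : MvPolynomial σ ℤ, X k - X (Equiv.swap a b k) = (X a - X b) * r := by
      by_cases h1 : k = a
      · subst h1
        exact ⟨1, by simp⟩
      · by_cases h2 : k = b
        · subst h2
          exact ⟨-1, by simp⟩
        · exact ⟨0, by simp [Equiv.swap_apply_of_ne_of_ne h1 h2]⟩
    obtain ⟨r, hr⟩ := hk
    refine ⟨p' * X k + rename (Equiv.swap a b) p * r, ?_⟩
    rw [map_mul, rename_X]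
    linear_combination X k * hp' + rename (Equiv.swap a b) p * hr

/-- The divided difference `(P - P with X a and X b exchanged) / (X a - X b)`. For `a ≠ b` the
quotient is unique, because the polynomial ring over `ℤ` is a domain. -/
noncomputable def divDiff {σ : Type*} [DecidableEq σ] (a b : σ) (P : MvPolynomial σ ℤ) :
    MvPolynomial σ ℤ :=
  (exists_divDiff a b P).choose

/-! ### Double and single Schubert polynomials

Everything is indexed from `0`: a permutation of `{1, …, n}` is an element of
`Equiv.Perm (Fin n)`, the variables `x` are `X (Sum.inl i)` and the variables `y` are
`X (Sum.inr j)`. -/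

/-- `w(i) < w(i+1)`, that is, `ℓ(w s_i) > ℓ(w)`. -/
def IsAscent {n : ℕ} (w : Equiv.Perm (Fin n)) (i : ℕ) : Prop :=
  ∃ h : i + 1 < n, w ⟨i, Nat.lt_of_succ_lt h⟩ < w ⟨i + 1, h⟩

/-- The simple transposition `s_i`, exchanging `i` and `i + 1`. -/
def simpleTransposition {n : ℕ} (i : ℕ) (h : i + 1 < n) : Equiv.Perm (Fin n) :=
  Equiv.swap ⟨i, Nat.lt_of_succ_lt h⟩ ⟨i + 1, h⟩

/-- The pairs of positions that are not inverted by `w`. -/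
def noninversions {n : ℕ} (w : Equiv.Perm (Fin n)) : Finset (Fin n × Fin n) :=
  Finset.univ.filter fun p => p.1 < p.2 ∧ w p.1 < w p.2

theorem card_noninversions_lt {n : ℕ} (w : Equiv.Perm (Fin n)) (i : ℕ) (hi : IsAscent w i) :
    (noninversions (w * simpleTransposition i hi.1)).card < (noninversions w).card := by
  obtain ⟨h, hw⟩ := hi
  set s := simpleTransposition i h with hs
  have key : ∀ p ∈ noninversions (w * s), (s p.1, s p.2) ∈
      (noninversions w).erase (⟨i, Nat.lt_of_succ_lt h⟩, ⟨i + 1, h⟩) := by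
    rintro ⟨a, b⟩ hp
    have hp := (Finset.mem_filter.mp (show (a, b) ∈ Finset.univ.filter _ from hp)).2
    simp only [Equiv.Perm.mul_apply] at hp
    simp only [noninversions, Finset.mem_erase, Finset.mem_filter, Finset.mem_univ, true_and]
    obtain ⟨hab, hwab⟩ := hp
    simp only [hs, simpleTransposition, Equiv.swap_apply_def] at hwab ⊢
    simp only [ne_eq, Prod.mk.injEq]
    refine ⟨?_, ?_, hwab⟩
    · grind
    · grind
  have hmem : ((⟨i, Nat.lt_of_succ_lt h⟩, ⟨i + 1, h⟩) : Fin n × Fin n) ∈ noninversions w := by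
    simp only [noninversions, Finset.mem_filter, Finset.mem_univ, true_and]
    exact ⟨Fin.mk_lt_mk.mpr (Nat.lt_succ_self i), hw⟩
  refine (Finset.card_le_card_of_injOn _ key ?_).trans_lt (Finset.card_erase_lt_of_mem hmem)
  rintro ⟨a, b⟩ _ ⟨c, d⟩ _ he
  simpa using he

open Classical in
/-- The double Schubert polynomial `𝔖_w(x; y)` of `w ∈ S_n`. If `w` has no ascent, then `w` is the
longest permutation `w₀` and `𝔖_w = ∏_{i + j ≤ n} (x_i - y_j)` (with `i`, `j` counted from `1`).
Otherwise `𝔖_w = ∂_i 𝔖_{w s_i}` for an ascent `i` of `w`; by the braid relations the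
choice of the ascent does not matter, and the least one is taken. -/
noncomputable def doubleSchubert {n : ℕ} (w : Equiv.Perm (Fin n)) :
    MvPolynomial (Fin n ⊕ Fin n) ℤ :=
  if h : ∃ i, IsAscent w i then
    divDiff (Sum.inl ⟨Nat.find h, Nat.lt_of_succ_lt (Nat.find_spec h).1⟩)
      (Sum.inl ⟨Nat.find h + 1, (Nat.find_spec h).1⟩)
      (doubleSchubert (w * simpleTransposition (Nat.find h) (Nat.find_spec h).1))
  else
    ∏ p : Fin n × Fin n with (p.1 : ℕ) + 1 + ((p.2 : ℕ) + 1) ≤ n,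
      (X (Sum.inl p.1) - X (Sum.inr p.2))
termination_by (noninversions w).card
decreasing_by exact card_noninversions_lt w _ (Nat.find_spec h)

/-- The single Schubert polynomial `𝔖_w(x) = 𝔖_w(x; 0)`. -/
noncomputable def schubert {n : ℕ} (w : Equiv.Perm (Fin n)) : MvPolynomial (Fin n) ℤ :=
  aeval (Sum.elim X (fun _ => 0)) (doubleSchubert w)

/-- The polynomial is a monomial `x^m`. -/
def IsMonomial {n : ℕ} (P : MvPolynomial (Fin n) ℤ) : Prop :=
  ∃ m : Fin n →₀ ℕ, P = monomial m 1

/-- The polynomial is a (possibly empty) product of binomials `x_i - y_j`, with repetitions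
allowed. -/
def IsBinomialProduct {n : ℕ} (P : MvPolynomial (Fin n ⊕ Fin n) ℤ) : Prop :=
  ∃ s : Multiset (Fin n × Fin n),
    P = (s.map fun p => X (Sum.inl p.1) - X (Sum.inr p.2)).prod

/-! ### Dominant permutations -/

/-- The values not among `w(1), …, w(i-1)`. -/
def remainingValues {n : ℕ} (w : Equiv.Perm (Fin n)) (i : Fin n) : Finset (Fin n) :=
  Finset.univ \ (Finset.univ.filter fun k => k < i).image w

/-- `w = w(lam)`: for every `i`, the value `w(i)` is the `(lam i + 1)`-st element, in increasing
order, of `{1, …, n} \ {w(1), …, w(i-1)}`. -/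
def IsPermutationOf {n : ℕ} (lam : Fin n → ℕ) (w : Equiv.Perm (Fin n)) : Prop :=
  ∀ i, w i ∈ remainingValues w i ∧ ((remainingValues w i).filter fun a => a < w i).card = lam i

/-- `w ∈ S_n` is dominant: it is `w(lam)` for a partition `lam` with `lam_i + i ≤ n` for all `i`
(counted from `1`). -/
def IsDominant {n : ℕ} (w : Equiv.Perm (Fin n)) : Prop :=
  ∃ lam : Fin n → ℕ, Antitone lam ∧ (∀ i, lam i + ((i : ℕ) + 1) ≤ n) ∧ IsPermutationOf lam w

/-- The diagram of `w`: the cells `(i, j)` with `j < w(i)` and `i < w⁻¹(j)`. -/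
def diagram {n : ℕ} (w : Equiv.Perm (Fin n)) : Finset (ℕ × ℕ) :=
  (Finset.univ.filter fun p : Fin n × Fin n => p.2 < w p.1 ∧ p.1 < w⁻¹ p.2).image
    fun p => ((p.1 : ℕ), (p.2 : ℕ))

end Schubert

namespace Schubert

open MvPolynomial

/-! ### Divided differences: invariance, commutation and the braid relation. -/

section DivDiff

variable {σ : Type*}

/-! Dominance means that the Lehmer code `c` of `w` is weakly decreasing. Row `i` of the diagram has
`c i` cells, and for decreasing `c` they are the first `c i` cells, which settles the Young diagram
criterion.

For decreasing `c`, `𝔖_w = ∏_i ∏_{j < c i} (x_i - y_j)` (`doubleSchubert_of_antitone`). At the least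
ascent `a`, the code of `w s_a` is `c` with one cell added to row `a`. So `𝔖_{w s_a} = (x_a - y_k)
G` with `G` symmetric in `x_a, x_{a+1}`, and `∂_a` returns `G`. Setting `y = 0` turns a product of
binomials into a monomial.

Conversely, `x^c` always has coefficient `1` in `𝔖_w` (`coeff_lehmerCode_schubert`). If `c a < c
(a+1)`, then `a` is an ascent, so `𝔖_w` is symmetric in `x_a, x_{a+1}` and contains a second
monomial. This symmetry uses the recursion at an arbitrary ascent (`doubleSchubert_eq_divDiff`),
hence the braid relations. -/

theorem X_sub_X_ne_zero {a b : σ} (h : a ≠ b) : (X a - X b : MvPolynomial σ ℤ) ≠ 0 :=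
  sub_ne_zero.mpr fun e => h (X_injective e)

variable [DecidableEq σ]

theorem sub_mul_divDiff (a b : σ) (P : MvPolynomial σ ℤ) :
    (X a - X b) * divDiff a b P = P - rename (Equiv.swap a b) P :=
  (exists_divDiff a b P).choose_spec.symm

theorem divDiff_eq_of_mul {a b : σ} (h : a ≠ b) {P Q : MvPolynomial σ ℤ}
    (hQ : (X a - X b) * Q = P - rename (Equiv.swap a b) P) : divDiff a b P = Q :=
  mul_left_cancel₀ (X_sub_X_ne_zero h) ((sub_mul_divDiff a b P).trans hQ.symm)

theorem rename_swap_rename_swap (a b : σ) (P : MvPolynomial σ ℤ) :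
    rename (Equiv.swap a b) (rename (Equiv.swap a b) P) = P := by
  rw [rename_rename, ← Equiv.coe_trans]
  simp

theorem rename_swap_divDiff {a b : σ} (h : a ≠ b) (P : MvPolynomial σ ℤ) :
    rename (Equiv.swap a b) (divDiff a b P) = divDiff a b P := by
  symm
  apply divDiff_eq_of_mul h
  have := congrArg (rename (Equiv.swap a b)) (sub_mul_divDiff a b P)
  simp only [map_mul, map_sub, rename_X, Equiv.swap_apply_left, Equiv.swap_apply_right,
    rename_swap_rename_swap] at this
  linear_combination -this

theorem divDiff_comm {a b c d : σ} (hab : a ≠ b) (hcd : c ≠ d) (hac : a ≠ c) (had : a ≠ d)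
    (hbc : b ≠ c) (hbd : b ≠ d) (P : MvPolynomial σ ℤ) :
    divDiff a b (divDiff c d P) = divDiff c d (divDiff a b P) := by
  have hcomm : ∀ R : MvPolynomial σ ℤ, rename (Equiv.swap a b) (rename (Equiv.swap c d) R) =
      rename (Equiv.swap c d) (rename (Equiv.swap a b) R) := by
    intro R
    rw [rename_rename, rename_rename]
    congr 2
    funext x
    simp only [Function.comp_apply, Equiv.swap_apply_def]
    grind
  apply divDiff_eq_of_mul hab
  apply mul_left_cancel₀ (X_sub_X_ne_zero hcd)
  have h1 := sub_mul_divDiff c d P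
  have h2 := sub_mul_divDiff a b P
  have h3 := sub_mul_divDiff c d (divDiff a b P)
  have h4 := congrArg (rename (Equiv.swap a b)) h1
  have h5 := congrArg (rename (Equiv.swap c d)) h2
  simp only [map_mul, map_sub, rename_X, Equiv.swap_apply_of_ne_of_ne hac.symm hbc.symm,
    Equiv.swap_apply_of_ne_of_ne had.symm hbd.symm, hcomm] at h4
  simp only [map_mul, map_sub, rename_X, Equiv.swap_apply_of_ne_of_ne hac had,
    Equiv.swap_apply_of_ne_of_ne hbc hbd] at h5
  linear_combination (X a - X b) * h3 + h2 - h5 - h1 + h4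

/-- The right side is the alternating sum of `P` over the permutations of `a, b, c`; it makes the
braid relation visible. -/
theorem mul_divDiff_divDiff_divDiff {a b c : σ} (hab : a ≠ b) (hac : a ≠ c) (hbc : b ≠ c)
    (P : MvPolynomial σ ℤ) :
    (X a - X b) * (X b - X c) * (X a - X c) * divDiff a b (divDiff b c (divDiff a b P)) =
      P - rename (Equiv.swap a b) P - rename (Equiv.swap b c) P
        + rename (Equiv.swap b c) (rename (Equiv.swap a b) P)
        + rename (Equiv.swap a b) (rename (Equiv.swap b c) P)
        - rename (Equiv.swap a b) (rename (Equiv.swap b c) (rename (Equiv.swap a b) P)) := by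
  set Q := divDiff a b P with hQ
  have h1 : (X a - X b) * Q = _ := sub_mul_divDiff a b P
  have h2 := sub_mul_divDiff b c Q
  have h3 := sub_mul_divDiff a b (divDiff b c Q)
  have h0 : rename (Equiv.swap a b) Q = Q := rename_swap_divDiff hab P
  have h4 := congrArg (rename (Equiv.swap b c)) h1
  have h5 := congrArg (rename (Equiv.swap a b)) h4
  have h6 := congrArg (rename (Equiv.swap a b)) h2
  simp only [map_mul, map_sub, rename_X, Equiv.swap_apply_left, Equiv.swap_apply_right,
    Equiv.swap_apply_of_ne_of_ne hab hac, Equiv.swap_apply_of_ne_of_ne hac.symm hbc.symm,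
    h0] at h4 h5 h6
  linear_combination (X b - X c) * (X a - X c) * h3 + (X a - X c) * h2 - (X b - X c) * h6
    + h1 - h4 + h5

theorem divDiff_braid {a b c : σ} (hab : a ≠ b) (hac : a ≠ c) (hbc : b ≠ c)
    (P : MvPolynomial σ ℤ) :
    divDiff a b (divDiff b c (divDiff a b P)) = divDiff b c (divDiff a b (divDiff b c P)) := by
  have h1 := mul_divDiff_divDiff_divDiff hab hac hbc P
  -- Same formula with `a` and `c` exchanged: the Vandermonde factor and the triple divided
  -- difference each change sign, so the signs cancel.
  have h2 := mul_divDiff_divDiff_divDiff hbc.symm hac.symm hab.symm P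
  have hneg : ∀ (x y : σ) (R : MvPolynomial σ ℤ), x ≠ y → divDiff x y R = - divDiff y x R := by
    intro x y R hxy
    apply divDiff_eq_of_mul hxy
    have := sub_mul_divDiff y x R
    rw [Equiv.swap_comm] at this
    linear_combination this
  have hnn : ∀ (x y : σ) (R : MvPolynomial σ ℤ), x ≠ y → divDiff x y (-R) = - divDiff x y R := by
    intro x y R hxy
    apply divDiff_eq_of_mul hxy
    rw [map_neg]
    linear_combination - sub_mul_divDiff x y R
  rw [hneg c b _ hbc.symm, hneg b a _ hab.symm, hneg c b _ hbc.symm, hnn _ _ _ hab,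
    hnn _ _ _ hbc, hnn _ _ _ hbc, Equiv.swap_comm c b, Equiv.swap_comm b a] at h2
  have hbr : rename (Equiv.swap a b) (rename (Equiv.swap b c) (rename (Equiv.swap a b) P)) =
      rename (Equiv.swap b c) (rename (Equiv.swap a b) (rename (Equiv.swap b c) P)) := by
    simp only [rename_rename]
    congr 2
    funext x
    simp only [Function.comp_apply, Equiv.swap_apply_def]
    grind
  apply mul_left_cancel₀ (mul_ne_zero (mul_ne_zero (X_sub_X_ne_zero hab) (X_sub_X_ne_zero hbc))
    (X_sub_X_ne_zero hac))
  linear_combination h1 - h2 - hbr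

end DivDiff

/-! ### Independence of the choice of ascent. -/

section Recursion

variable {n : ℕ}

theorem card_noninversions_mul_swap_lt (w : Equiv.Perm (Fin n)) {a b : Fin n}
    (hab : (a : ℕ) + 1 = b) (hw : w a < w b) :
    (noninversions (w * Equiv.swap a b)).card < (noninversions w).card := by
  obtain ⟨b, hb⟩ := b
  subst hab
  exact card_noninversions_lt w a ⟨hb, hw⟩

open Classical in
theorem exists_least_ascent (w : Equiv.Perm (Fin n)) (h : ∃ i, IsAscent w i) :
    ∃ a b : Fin n, (a : ℕ) + 1 = b ∧ w a < w b ∧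
      (∀ c d : Fin n, (c : ℕ) + 1 = d → w c < w d → a ≤ c) ∧
      doubleSchubert w =
        divDiff (Sum.inl a) (Sum.inl b) (doubleSchubert (w * Equiv.swap a b)) := by
  refine ⟨⟨Nat.find h, Nat.lt_of_succ_lt (Nat.find_spec h).1⟩,
    ⟨Nat.find h + 1, (Nat.find_spec h).1⟩, rfl, (Nat.find_spec h).2, ?_, ?_⟩
  · rintro c ⟨d, hd⟩ hcd hw
    subst hcd
    exact Nat.find_min' h ⟨hd, hw⟩
  · rw [doubleSchubert, dif_pos h]
    rfl

theorem doubleSchubert_of_not_ascent (w : Equiv.Perm (Fin n)) (h : ¬ ∃ i, IsAscent w i) :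
    doubleSchubert w = ∏ p : Fin n × Fin n with (p.1 : ℕ) + 1 + ((p.2 : ℕ) + 1) ≤ n,
      (X (Sum.inl p.1) - X (Sum.inr p.2)) := by
  rw [doubleSchubert, dif_neg h]

/-- The defining recursion of the double Schubert polynomials holds at every ascent. -/
theorem doubleSchubert_eq_divDiff (w : Equiv.Perm (Fin n)) {a b : Fin n}
    (hab : (a : ℕ) + 1 = b) (hw : w a < w b) :
    doubleSchubert w =
      divDiff (Sum.inl a) (Sum.inl b) (doubleSchubert (w * Equiv.swap a b)) := by
  induction hN : (noninversions w).card using Nat.strong_induction_on generalizing w a b with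
  | _ N ih =>
  subst hN
  obtain ⟨c, d, hcd, hwc, hmin, heq⟩ :=
    exists_least_ascent w ⟨a, by rw [hab]; exact b.2, by convert hw⟩
  have hca := hmin a b hab hw
  have ne1 : ∀ {p q : Fin n}, (p : ℕ) ≠ q → (Sum.inl p : Fin n ⊕ Fin n) ≠ Sum.inl q :=
    fun h e => h (congrArg Fin.val (Sum.inl_injective e))
  have ne2 : ∀ {p q : Fin n}, (p : ℕ) ≠ q → p ≠ q := fun h e => h (congrArg Fin.val e)
  have sa := card_noninversions_mul_swap_lt w hab hw
  have sc := card_noninversions_mul_swap_lt w hcd hwc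
  rcases hca.eq_or_lt with rfl | hlt
  · obtain rfl : b = d := Fin.ext (hab.symm.trans hcd)
    exact heq
  rw [Fin.lt_def] at hlt
  -- Adjacent ascents: both routes climb by three ascents to the same permutation, and the braid
  -- relation compares them. Otherwise the two transpositions commute.
  rcases (Nat.succ_le_of_lt hlt).eq_or_lt with hda | hda
  · obtain rfl : d = a := Fin.ext (hcd.symm.trans hda)
    have dc : d ≠ c := ne2 (by omega)
    have db : d ≠ b := ne2 (by omega)
    have cb : c ≠ b := ne2 (by omega)
    have e1 : (w * Equiv.swap c d) d < (w * Equiv.swap c d) b := by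
      simp [Equiv.swap_apply_of_ne_of_ne cb.symm db.symm]; exact hwc.trans hw
    have e2 : (w * Equiv.swap c d * Equiv.swap d b) c < (w * Equiv.swap c d * Equiv.swap d b) d := by
      simp [Equiv.swap_apply_of_ne_of_ne dc.symm cb,
        Equiv.swap_apply_of_ne_of_ne cb.symm db.symm]; exact hw
    have f1 : (w * Equiv.swap d b) c < (w * Equiv.swap d b) d := by
      simp [Equiv.swap_apply_of_ne_of_ne dc.symm cb]; exact hwc.trans hw
    have f2 : (w * Equiv.swap d b * Equiv.swap c d) d < (w * Equiv.swap d b * Equiv.swap c d) b := by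
      simp [Equiv.swap_apply_of_ne_of_ne dc.symm cb,
        Equiv.swap_apply_of_ne_of_ne cb.symm db.symm]; exact hwc
    have sc' := card_noninversions_mul_swap_lt _ hab e1
    have sa' := card_noninversions_mul_swap_lt _ hcd f1
    rw [heq, ih _ sc _ hab e1 rfl, ih _ (sc'.trans sc) _ hcd e2 rfl, ih _ sa _ hcd f1 rfl,
      ih _ (sa'.trans sa) _ hab f2 rfl, divDiff_braid (ne1 (by omega)) (ne1 (by omega))
      (ne1 (by omega))]
    congr 4
    simp only [mul_assoc]
    congr 1
    ext x
    simp only [Equiv.Perm.mul_apply, Equiv.swap_apply_def]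
    grind
  · have ca : c ≠ a := ne2 (by omega)
    have cb : c ≠ b := ne2 (by omega)
    have da : d ≠ a := ne2 (by omega)
    have db : d ≠ b := ne2 (by omega)
    have e1 : (w * Equiv.swap c d) a < (w * Equiv.swap c d) b := by
      simpa [Equiv.swap_apply_of_ne_of_ne ca.symm da.symm,
        Equiv.swap_apply_of_ne_of_ne cb.symm db.symm] using hw
    have f1 : (w * Equiv.swap a b) c < (w * Equiv.swap a b) d := by
      simpa [Equiv.swap_apply_of_ne_of_ne ca cb, Equiv.swap_apply_of_ne_of_ne da db] using hwc
    rw [heq, ih _ sc _ hab e1 rfl, ih _ sa _ hcd f1 rfl, divDiff_comm (ne1 (by omega))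
      (ne1 (by omega)) (ne1 (by omega)) (ne1 (by omega)) (ne1 (by omega)) (ne1 (by omega))]
    congr 3
    simp only [mul_assoc]
    congr 1
    ext x
    simp only [Equiv.Perm.mul_apply, Equiv.swap_apply_def]
    grind

end Recursion

/-! ### The Lehmer code, the diagram, and multiplication by a simple transposition. -/

section Code

variable {n : ℕ}

/-- The Lehmer code of a permutation. -/
def lehmerCode (w : Equiv.Perm (Fin n)) (i : Fin n) : ℕ :=
  (Finset.univ.filter fun k => i < k ∧ w k < w i).card

theorem lehmerCode_add_le (w : Equiv.Perm (Fin n)) (i : Fin n) :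
    lehmerCode w i + ((i : ℕ) + 1) ≤ n := by
  have h : lehmerCode w i ≤ (Finset.Ioi i).card :=
    Finset.card_le_card fun k hk => by simp at hk ⊢; exact hk.1
  rw [Fin.card_Ioi] at h
  have := i.2
  omega

theorem card_filter_remainingValues (w : Equiv.Perm (Fin n)) (i : Fin n) :
    ((remainingValues w i).filter fun a => a < w i).card = lehmerCode w i := by
  rw [lehmerCode, ← Finset.card_image_of_injective
    (Finset.univ.filter fun k => i < k ∧ w k < w i) w.injective]
  congr 1
  ext v
  obtain ⟨k, rfl⟩ := w.surjective v
  simp only [remainingValues, Finset.mem_filter, Finset.mem_sdiff, Finset.mem_univ, true_and,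
    Finset.mem_image, EmbeddingLike.apply_eq_iff_eq, exists_eq_right, not_lt]
  constructor
  · rintro ⟨h1, h2⟩
    exact ⟨lt_of_le_of_ne h1 (by rintro rfl; exact lt_irrefl _ h2), h2⟩
  · rintro ⟨h1, h2⟩
    exact ⟨h1.le, h2⟩

theorem isDominant_iff_antitone_lehmerCode (w : Equiv.Perm (Fin n)) :
    IsDominant w ↔ Antitone (lehmerCode w) := by
  constructor
  · rintro ⟨lam, hlam, -, h⟩
    convert hlam
    funext i
    rw [← (h i).2, card_filter_remainingValues]
  · intro h
    refine ⟨lehmerCode w, h, lehmerCode_add_le w, fun i => ⟨?_, card_filter_remainingValues w i⟩⟩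
    simp [remainingValues]

theorem card_diagram_row (w : Equiv.Perm (Fin n)) (i : Fin n) :
    (Finset.univ.filter fun j => j < w i ∧ i < w⁻¹ j).card = lehmerCode w i := by
  rw [lehmerCode, ← Finset.card_image_of_injective
    (Finset.univ.filter fun k => i < k ∧ w k < w i) w.injective]
  congr 1
  ext v
  obtain ⟨k, rfl⟩ := w.surjective v
  simp [and_comm]

theorem mem_diagram_iff (w : Equiv.Perm (Fin n)) (i j : Fin n) :
    ((i : ℕ), (j : ℕ)) ∈ diagram w ↔ j < w i ∧ i < w⁻¹ j := by
  simp only [diagram, Finset.mem_image, Finset.mem_filter, Finset.mem_univ, true_and,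
    Prod.mk.injEq, Prod.exists]
  constructor
  · rintro ⟨a, b, h, ha, hb⟩
    rwa [← Fin.ext ha, ← Fin.ext hb]
  · intro h
    exact ⟨i, j, h, rfl, rfl⟩

theorem lehmerCode_le_apply (w : Equiv.Perm (Fin n)) (i : Fin n) : lehmerCode w i ≤ w i := by
  rw [← card_diagram_row, ← Fin.card_Iio]
  exact Finset.card_le_card fun k hk => by simp at hk ⊢; exact hk.1

theorem mem_diagram_iff_of_antitone {w : Equiv.Perm (Fin n)} (h : Antitone (lehmerCode w))
    (i j : Fin n) : ((i : ℕ), (j : ℕ)) ∈ diagram w ↔ (j : ℕ) < lehmerCode w i := by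
  have hi : (Finset.univ.filter fun j : Fin n => (j : ℕ) < lehmerCode w i) =
      Finset.univ.filter fun j => j < w i ∧ i < w⁻¹ j := by
    -- Both sets have `lehmerCode w i` elements, so one inclusion suffices. If `k` were a value at a
    -- position `≤ i`, monotonicity would give `lehmerCode w i ≤ k`.
    apply Finset.eq_of_subset_of_card_le
    · intro k hk
      simp only [Finset.mem_filter, Finset.mem_univ, true_and] at hk ⊢
      refine ⟨Fin.lt_def.mpr (hk.trans_le (lehmerCode_le_apply w i)), ?_⟩
      by_contra! hc
      have := lehmerCode_le_apply w (w⁻¹ k)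
      rw [← Equiv.Perm.mul_apply, mul_inv_cancel, Equiv.Perm.one_apply] at this
      exact absurd (hk.trans_le ((h hc).trans this)) (lt_irrefl _)
    · have := lehmerCode_add_le w i
      rw [card_diagram_row, Fin.card_filter_val_lt]
      omega
  rw [mem_diagram_iff]
  simpa using (Finset.ext_iff.mp hi j).symm

theorem antitone_lehmerCode_iff_isLowerSet (w : Equiv.Perm (Fin n)) :
    Antitone (lehmerCode w) ↔ IsLowerSet (diagram w : Set (ℕ × ℕ)) := by
  constructor
  · rintro h ⟨i, j⟩ ⟨i', j'⟩ ⟨hi, hj⟩ hm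
    simp only at hi hj
    have hm' : (i, j) ∈ diagram w := hm
    obtain ⟨⟨a, b⟩, -, hab⟩ := Finset.mem_image.mp hm'
    simp only [Prod.mk.injEq] at hab
    obtain ⟨rfl, rfl⟩ := hab
    rw [mem_diagram_iff_of_antitone h] at hm'
    have hi' := hi.trans_lt a.2
    have hj' := hj.trans_lt b.2
    exact (mem_diagram_iff_of_antitone h ⟨i', hi'⟩ ⟨j', hj'⟩).mpr
      ((hj.trans_lt hm').trans_le (h hi))
  · intro h i i' hi
    rw [← card_diagram_row, ← card_diagram_row]
    refine Finset.card_le_card fun j hj => ?_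
    simp only [Finset.mem_filter, Finset.mem_univ, true_and, ← mem_diagram_iff] at hj ⊢
    exact h (show ((i : ℕ), (j : ℕ)) ≤ ((i' : ℕ), (j : ℕ)) from ⟨hi, le_rfl⟩) hj

theorem lehmerCode_lt_of_lt (w : Equiv.Perm (Fin n)) {a b : Fin n} (hab : a < b)
    (hw : w b < w a) : lehmerCode w b < lehmerCode w a := by
  refine Finset.card_lt_card (Finset.ssubset_iff_of_subset ?_ |>.mpr ⟨b, ?_, ?_⟩)
  · intro k hk
    simp only [Finset.mem_filter, Finset.mem_univ, true_and] at hk ⊢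
    exact ⟨hab.trans hk.1, hk.2.trans hw⟩
  · simpa using ⟨hab, hw⟩
  · simp

theorem lehmerCode_le_of_lt (w : Equiv.Perm (Fin n)) {a b : Fin n} (hab : (a : ℕ) + 1 = b)
    (hw : w a < w b) : lehmerCode w a ≤ lehmerCode w b := by
  refine Finset.card_le_card fun k hk => ?_
  simp only [Finset.mem_filter, Finset.mem_univ, true_and, Fin.lt_def] at hk hw ⊢
  have : (k : ℕ) ≠ b := fun e => by rw [Fin.ext e] at hk; omega
  omega

theorem lehmerCode_mul_swap_apply (w : Equiv.Perm (Fin n)) (a b i : Fin n) :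
    lehmerCode (w * Equiv.swap a b) i =
      (Finset.univ.filter fun k => i < Equiv.swap a b k ∧ w k < w (Equiv.swap a b i)).card := by
  rw [lehmerCode, ← Finset.card_image_of_injective
    (Finset.univ.filter fun k => i < k ∧ (w * Equiv.swap a b) k < (w * Equiv.swap a b) i)
    (Equiv.swap a b).injective]
  congr 1
  ext v
  obtain ⟨k, rfl⟩ := (Equiv.swap a b).surjective v
  rw [(Equiv.swap a b).injective.mem_finset_image, Finset.mem_filter, Finset.mem_filter]
  simp

theorem lehmerCode_mul_swap_left (w : Equiv.Perm (Fin n)) {a b : Fin n} (hab : (a : ℕ) + 1 = b)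
    (hw : w a < w b) : lehmerCode (w * Equiv.swap a b) a = lehmerCode w b + 1 := by
  rw [lehmerCode_mul_swap_apply, lehmerCode, Equiv.swap_apply_left,
    ← Finset.card_insert_of_notMem (a := a)]
  · congr 1
    ext k
    simp only [Finset.mem_filter, Finset.mem_univ, true_and, Finset.mem_insert,
      Equiv.swap_apply_def]
    grind
  · simp only [Finset.mem_filter, Fin.lt_def]
    omega

theorem lehmerCode_mul_swap_right (w : Equiv.Perm (Fin n)) {a b : Fin n} (hab : (a : ℕ) + 1 = b)
    (hw : w a < w b) : lehmerCode (w * Equiv.swap a b) b = lehmerCode w a := by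
  rw [lehmerCode_mul_swap_apply, lehmerCode, Equiv.swap_apply_right]
  congr 1
  ext k
  simp only [Finset.mem_filter, Finset.mem_univ, true_and, Equiv.swap_apply_def]
  grind

theorem lehmerCode_mul_swap_of_ne (w : Equiv.Perm (Fin n)) {a b i : Fin n}
    (hab : (a : ℕ) + 1 = b) (ha : i ≠ a) (hb : i ≠ b) :
    lehmerCode (w * Equiv.swap a b) i = lehmerCode w i := by
  rw [lehmerCode_mul_swap_apply, lehmerCode, Equiv.swap_apply_of_ne_of_ne ha hb]
  congr 1
  ext k
  simp only [Finset.mem_filter, Finset.mem_univ, true_and, Equiv.swap_apply_def]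
  grind

theorem lehmerCode_of_not_ascent (w : Equiv.Perm (Fin n)) (h : ¬ ∃ i, IsAscent w i) (i : Fin n) :
    lehmerCode w i = n - (i + 1) := by
  have key : ∀ (d : ℕ) (a b : Fin n), (a : ℕ) + d + 1 = b → w b < w a := by
    intro d
    induction d with
    | zero =>
      rintro a ⟨b, hb⟩ hab
      simp only [add_zero] at hab
      subst hab
      by_contra! hc
      exact h ⟨a, hb, lt_of_le_of_ne hc (by simp [Fin.ext_iff])⟩
    | succ d ih =>
      intro a b hab
      have hc : (a : ℕ) + d + 1 < n := by have := b.2; omega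
      refine lt_trans ?_ (ih a ⟨_, hc⟩ rfl)
      by_contra! hc'
      have hb : (a : ℕ) + d + 1 + 1 < n := by have := b.2; omega
      obtain rfl : b = ⟨_, hb⟩ := Fin.ext (by simp; omega)
      exact h ⟨_, hb, lt_of_le_of_ne hc' (by simp [Fin.ext_iff])⟩
  rw [lehmerCode, show (Finset.univ.filter fun k => i < k ∧ w k < w i) = Finset.Ioi i from ?_,
    Fin.card_Ioi]
  · omega
  · ext k
    simp only [Finset.mem_filter, Finset.mem_univ, true_and, Finset.mem_Ioi, and_iff_left_iff_imp]
    intro hk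
    exact key (k - i - 1) i k (by rw [Fin.lt_def] at hk; omega)

theorem antitone_lehmerCode_of_not_ascent (w : Equiv.Perm (Fin n))
    (h : ¬ ∃ i, IsAscent w i) : Antitone (lehmerCode w) := by
  intro i j hij
  rw [lehmerCode_of_not_ascent w h, lehmerCode_of_not_ascent w h]
  rw [Fin.le_def] at hij
  omega

/-- Leastness of the ascent matters: all positions before `a` are descents, so the code drops
strictly there and leaves room for one more cell in row `a`. -/
theorem antitone_lehmerCode_mul_swap {w : Equiv.Perm (Fin n)} (h : Antitone (lehmerCode w))
    {a b : Fin n} (hab : (a : ℕ) + 1 = b) (hw : w a < w b)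
    (hmin : ∀ c d : Fin n, (c : ℕ) + 1 = d → w c < w d → a ≤ c) :
    Antitone (lehmerCode (w * Equiv.swap a b)) := by
  have hk : lehmerCode w a = lehmerCode w b :=
    (lehmerCode_le_of_lt w hab hw).antisymm (h (Fin.le_def.mpr (by omega)))
  have hlt : ∀ p : Fin n, p < a → lehmerCode w a < lehmerCode w p := by
    intro p hp
    rw [Fin.lt_def] at hp
    have hc : (a : ℕ) - 1 < n := by have := a.2; omega
    refine (lehmerCode_lt_of_lt w (a := ⟨_, hc⟩) (by rw [Fin.lt_def]; simp; omega) ?_).trans_le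
      (h (Fin.le_def.mpr (by simp; omega)))
    by_contra! hc'
    have := hmin ⟨_, hc⟩ a (by simp; omega) (lt_of_le_of_ne hc' fun e => by
      have := congrArg Fin.val (w.injective e)
      simp at this
      omega)
    rw [Fin.le_def] at this
    simp at this
    omega
  -- Passing to `w s_a` replaces the entries `(c a, c b)` by `(c b + 1, c a)`; here `c a = c b`.
  have hval : ∀ i, lehmerCode (w * Equiv.swap a b) i =
      if i = a then lehmerCode w a + 1 else lehmerCode w i := by
    intro i
    split_ifs with h1
    · rw [h1, lehmerCode_mul_swap_left w hab hw, hk]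
    · by_cases h2 : i = b
      · rw [h2, lehmerCode_mul_swap_right w hab hw, hk]
      · exact lehmerCode_mul_swap_of_ne w hab h1 h2
  intro i j hij
  rw [hval, hval]
  split_ifs with h1 h2 h2
  · rfl
  · exact hlt i (lt_of_le_of_ne (h1 ▸ hij) h2)
  · exact (h hij).trans (by rw [h2]; omega)
  · exact h hij

end Code

/-! ### Product formulas for dominant permutations. -/

section Dominant

variable {n : ℕ}

/-- The double Schubert polynomial of a dominant permutation. -/
theorem doubleSchubert_of_antitone (w : Equiv.Perm (Fin n)) (h : Antitone (lehmerCode w)) :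
    doubleSchubert w = ∏ i : Fin n, ∏ j ∈ Finset.univ.filter (fun j : Fin n => (j : ℕ) < lehmerCode w i),
      (X (Sum.inl i) - X (Sum.inr j)) := by
  induction hN : (noninversions w).card using Nat.strong_induction_on generalizing w with
  | _ N ih =>
  subst hN
  by_cases hasc : ∃ i, IsAscent w i
  · obtain ⟨a, b, hab, hw, hmin, heq⟩ := exists_least_ascent w hasc
    have hne : a ≠ b := fun e => by rw [e] at hab; omega
    have hk : lehmerCode w b = lehmerCode w a :=
      (h (Fin.le_def.mpr (by omega))).antisymm (lehmerCode_le_of_lt w hab hw)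
    rw [heq, ih _ (card_noninversions_mul_swap_lt w hab hw) _
      (antitone_lehmerCode_mul_swap h hab hw hmin) rfl]
    have hkn : lehmerCode w a < n := by have := lehmerCode_add_le w a; omega
    set G : MvPolynomial (Fin n ⊕ Fin n) ℤ :=
      ∏ i : Fin n, ∏ j ∈ Finset.univ.filter (fun j : Fin n => (j : ℕ) < lehmerCode w i),
        (X (Sum.inl i) - X (Sum.inr j)) with hG
    have hsplit : (∏ i : Fin n, ∏ j ∈ Finset.univ.filter (fun j : Fin n => (j : ℕ) < lehmerCode (w * Equiv.swap a b) i),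
        (X (Sum.inl i) - X (Sum.inr j)) : MvPolynomial (Fin n ⊕ Fin n) ℤ) =
        (X (Sum.inl a) - X (Sum.inr ⟨lehmerCode w a, hkn⟩)) * G := by
      rw [hG, ← Finset.mul_prod_erase _ _ (Finset.mem_univ a),
        ← Finset.mul_prod_erase _ _ (Finset.mem_univ a), ← mul_assoc]
      congr 1
      · rw [lehmerCode_mul_swap_left w hab hw, hk,
          show (Finset.univ.filter fun j : Fin n => (j : ℕ) < lehmerCode w a + 1) =
            insert ⟨lehmerCode w a, hkn⟩
              (Finset.univ.filter fun j : Fin n => (j : ℕ) < lehmerCode w a) from ?_,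
          Finset.prod_insert (by simp)]
        ext j
        simp only [Finset.mem_filter, Finset.mem_univ, true_and, Finset.mem_insert, Fin.ext_iff]
        omega
      · refine Finset.prod_congr rfl fun i hi => ?_
        have hia := (Finset.mem_erase.mp hi).1
        by_cases hib : i = b
        · rw [hib, lehmerCode_mul_swap_right w hab hw, hk]
        · rw [lehmerCode_mul_swap_of_ne w hab hia hib]
    -- Rows `a` and `b` have equal length, so exchanging `x_a` and `x_b` only permutes the factors.
    have hsymm : rename (Equiv.swap (Sum.inl a) (Sum.inl b)) G = G := by
      rw [hG]
      simp only [map_prod, map_sub, rename_X]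
      refine Fintype.prod_equiv (Equiv.swap a b) _ _ fun i => ?_
      have hc : lehmerCode w (Equiv.swap a b i) = lehmerCode w i := by
        rw [Equiv.swap_apply_def]
        split_ifs with h1 h2
        · rw [h1, hk]
        · rw [h2, hk]
        · rfl
      rw [hc]
      refine Finset.prod_congr rfl fun j _ => ?_
      rw [Equiv.swap_apply_of_ne_of_ne (a := Sum.inl a) (b := Sum.inl b) (x := Sum.inr j)
        (by simp) (by simp), Sum.inl_injective.swap_apply]
    rw [hsplit]
    apply divDiff_eq_of_mul (fun e => hne (Sum.inl_injective e))
    rw [map_mul, hsymm, map_sub, rename_X, rename_X, Equiv.swap_apply_left,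
      Equiv.swap_apply_of_ne_of_ne (by simp) (by simp)]
    ring
  · rw [doubleSchubert_of_not_ascent w hasc, Finset.prod_filter, Fintype.prod_prod_type]
    refine Finset.prod_congr rfl fun i _ => ?_
    rw [Finset.prod_filter]
    refine Finset.prod_congr rfl fun j _ => ?_
    rw [lehmerCode_of_not_ascent w hasc]
    congr 1
    simp only [eq_iff_iff]
    omega

theorem isBinomialProduct_of_antitone (w : Equiv.Perm (Fin n)) (h : Antitone (lehmerCode w)) :
    IsBinomialProduct (doubleSchubert w) := by
  refine ⟨(Finset.univ.filter fun p : Fin n × Fin n => (p.2 : ℕ) < lehmerCode w p.1).val, ?_⟩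
  rw [doubleSchubert_of_antitone w h]
  change _ = ∏ p : Fin n × Fin n with (p.2 : ℕ) < lehmerCode w p.1,
    (X (Sum.inl p.1) - X (Sum.inr p.2))
  simp only [Finset.prod_filter, Fintype.prod_prod_type]

theorem schubert_of_antitone (w : Equiv.Perm (Fin n)) (h : Antitone (lehmerCode w)) :
    schubert w = monomial (Finsupp.equivFunOnFinite.symm (lehmerCode w)) 1 := by
  rw [schubert, doubleSchubert_of_antitone w h]
  simp only [map_prod, map_sub, aeval_X, Sum.elim_inl, Sum.elim_inr, sub_zero,
    Finset.prod_const, Fin.card_filter_val_lt]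
  rw [monomial_eq, Finsupp.prod_fintype _ _ (by simp)]
  simp only [map_one, one_mul, Finsupp.equivFunOnFinite_symm_apply_apply]
  refine Finset.prod_congr rfl fun i _ => ?_
  congr 1
  have := lehmerCode_add_le w i
  omega

theorem isMonomial_of_isBinomialProduct (w : Equiv.Perm (Fin n))
    (h : IsBinomialProduct (doubleSchubert w)) : IsMonomial (schubert w) := by
  obtain ⟨s, hs⟩ := h
  refine ⟨(s.map fun p => Finsupp.single p.1 1).sum, ?_⟩
  rw [schubert, hs]
  clear hs
  induction s using Multiset.induction_on with
  | empty => simp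
  | cons p s ih =>
    simp only [Multiset.map_cons, Multiset.prod_cons, Multiset.sum_cons, map_mul, ih, map_sub,
      aeval_X, Sum.elim_inl, Sum.elim_inr, sub_zero]
    rw [X, monomial_mul, one_mul]

end Dominant

/-! ### Coefficients and degrees of divided differences. -/

section Coeff

variable {σ : Type*} [DecidableEq σ]

theorem coeff_rename_swap (a b : σ) (P : MvPolynomial σ ℤ) (m : σ →₀ ℕ) :
    coeff m (rename (Equiv.swap a b) P) = coeff (m.mapDomain (Equiv.swap a b)) P := by
  conv_lhs => rw [show m = (m.mapDomain (Equiv.swap a b)).mapDomain (Equiv.swap a b) by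
    ext i; simp]
  exact coeff_rename_mapDomain _ (Equiv.injective _) _ _

theorem coeff_divDiff {a b : σ} (hab : a ≠ b) (P : MvPolynomial σ ℤ) {m : σ →₀ ℕ}
    (hm : m a = 0) :
    coeff m (divDiff a b P) =
      coeff ((m + Finsupp.single b 1).mapDomain (Equiv.swap a b)) P -
        coeff (m + Finsupp.single b 1) P := by
  -- At this exponent `X a * divDiff a b P` contributes nothing, because `X a` does not divide the
  -- monomial; only `-X b * divDiff a b P` remains.
  have h := congrArg (coeff (m + Finsupp.single b 1)) (sub_mul_divDiff a b P)
  rw [sub_mul, coeff_sub, coeff_sub, coeff_rename_swap, coeff_X_mul', if_neg,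
    mul_comm (X b), coeff_mul_X] at h
  · linarith
  · simp [hm, hab]

theorem degreeOf_divDiff_le {a b : σ} (hab : a ≠ b) (P : MvPolynomial σ ℤ) (j : σ) :
    degreeOf j (divDiff a b P) ≤ max (degreeOf j P) (degreeOf (Equiv.swap a b j) P) -
      (if j = a ∨ j = b then 1 else 0) := by
  by_cases hQ : divDiff a b P = 0
  · simp [hQ]
  have h := congrArg (degreeOf j) (sub_mul_divDiff a b P)
  rw [degreeOf_mul_eq (X_sub_X_ne_zero hab) hQ] at h
  have h1 := degreeOf_sub_le j P (rename (Equiv.swap a b) P)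
  have h2 : degreeOf j (rename (Equiv.swap a b) P) = degreeOf (Equiv.swap a b j) P := by
    conv_lhs => rw [← Equiv.swap_apply_self a b j]
    exact degreeOf_rename_of_injective (Equiv.injective _) _
  have h3 : (if j = a ∨ j = b then 1 else 0) ≤ degreeOf j (X a - X b : MvPolynomial σ ℤ) := by
    split_ifs with hj
    · have hmem : Finsupp.single j 1 ∈ (X a - X b : MvPolynomial σ ℤ).support := by
        rw [mem_support_iff, coeff_sub, coeff_X, coeff_X]
        rcases hj with rfl | rfl
        · simp [Finsupp.single_left_inj, hab.symm]
        · simp [Finsupp.single_left_inj, hab]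
      simpa using monomial_le_degreeOf j hmem
    · exact Nat.zero_le _
  rw [h2] at h1
  omega

end Coeff

/-! ### Single Schubert polynomials and the leading role of the code monomial. -/

section Single

variable {n : ℕ}

theorem schubert_eq_divDiff (w : Equiv.Perm (Fin n)) {a b : Fin n}
    (hab : (a : ℕ) + 1 = b) (hw : w a < w b) :
    schubert w = divDiff a b (schubert (w * Equiv.swap a b)) := by
  have hne : a ≠ b := fun e => by rw [e] at hab; omega
  -- Setting `y = 0` commutes with exchanging two `x` variables.
  have hcomp : (aeval (Sum.elim X fun _ => 0) :
        MvPolynomial (Fin n ⊕ Fin n) ℤ →ₐ[ℤ] MvPolynomial (Fin n) ℤ).comp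
        (rename (Equiv.swap (Sum.inl a) (Sum.inl b))) =
      (rename (Equiv.swap a b)).comp (aeval (Sum.elim X fun _ => 0)) := by
    apply MvPolynomial.algHom_ext
    rintro (i | j)
    · simp [Sum.inl_injective.swap_apply]
    · simp [Equiv.swap_apply_of_ne_of_ne]
  symm
  apply divDiff_eq_of_mul hne
  have h := congrArg (aeval (Sum.elim X fun _ => 0) :
    MvPolynomial (Fin n ⊕ Fin n) ℤ →ₐ[ℤ] MvPolynomial (Fin n) ℤ)
    (sub_mul_divDiff (Sum.inl a) (Sum.inl b) (doubleSchubert (w * Equiv.swap a b)))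
  rw [← doubleSchubert_eq_divDiff w hab hw] at h
  have hR := DFunLike.congr_fun hcomp (doubleSchubert (w * Equiv.swap a b))
  simp only [AlgHom.comp_apply] at hR
  simpa only [map_mul, map_sub, hR, aeval_X, Sum.elim_inl, schubert] using h

theorem coeff_schubert_mapDomain_swap (w : Equiv.Perm (Fin n)) {a b : Fin n}
    (hab : (a : ℕ) + 1 = b) (hw : w a < w b) (m : Fin n →₀ ℕ) :
    coeff (m.mapDomain (Equiv.swap a b)) (schubert w) = coeff m (schubert w) := by
  have hne : a ≠ b := fun e => by rw [e] at hab; omega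
  rw [← coeff_rename_swap, schubert_eq_divDiff w hab hw, rename_swap_divDiff hne]

/-- The staircase bound holds for `w₀` and survives `∂_a`: the degree lost in `x_a` and `x_b` makes
up for the weaker bound at `a` being passed to `b`. In particular the last variable never occurs. -/
theorem degreeOf_schubert_add_le (w : Equiv.Perm (Fin n)) (j : Fin n) :
    degreeOf j (schubert w) + (j + 1) ≤ n := by
  induction hN : (noninversions w).card using Nat.strong_induction_on generalizing w j with
  | _ N ih =>
  subst hN
  by_cases hasc : ∃ i, IsAscent w i
  · obtain ⟨a, b, hab, hw, -, -⟩ := exists_least_ascent w hasc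
    have hne : a ≠ b := fun e => by rw [e] at hab; omega
    rw [schubert_eq_divDiff w hab hw]
    have hlt := card_noninversions_mul_swap_lt w hab hw
    have h1 := degreeOf_divDiff_le hne (schubert (w * Equiv.swap a b)) j
    have h2 := ih _ hlt _ j rfl
    have h3 := ih _ hlt _ (Equiv.swap a b j) rfl
    have h4 := ih _ hlt _ a rfl
    have := b.2
    rw [Equiv.swap_apply_def] at h1 h3
    split_ifs at h1 h3 <;> subst_vars <;> grind
  · rw [schubert_of_antitone w (antitone_lehmerCode_of_not_ascent w hasc),
      degreeOf_monomial_eq _ _ one_ne_zero]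
    exact lehmerCode_add_le w j

/-- If `w` has no descent at or after position `b`, then `x_b` does not occur in `𝔖_w`. -/
theorem coeff_schubert_eq_zero (w : Equiv.Perm (Fin n)) (b : Fin n)
    (h : ∀ c d : Fin n, (c : ℕ) + 1 = d → b ≤ c → w c < w d) (m : Fin n →₀ ℕ) (hm : m b ≠ 0) :
    coeff m (schubert w) = 0 := by
  induction hk : n - (b : ℕ) using Nat.strong_induction_on generalizing b m with
  | _ k ih =>
  by_cases hb : (b : ℕ) + 1 < n
  · have hbd := h b ⟨_, hb⟩ rfl le_rfl
    -- Symmetry moves the exponent of `x_b` one step to the right, until it reaches the last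
    -- variable, where the degree bound forbids it.
    rw [← coeff_schubert_mapDomain_swap w rfl hbd]
    refine ih _ ?_ ⟨_, hb⟩ (fun c d hcd hc => h c d hcd ?_) _ ?_ rfl
    · simp only
      omega
    · rw [Fin.le_def] at hc ⊢
      simp only at hc
      omega
    · simpa using hm
  · by_contra hc
    have h1 := monomial_le_degreeOf b (mem_support_iff.mpr hc)
    have h2 := degreeOf_schubert_add_le w b
    omega

/-- The monomial given by the Lehmer code occurs in the Schubert polynomial with coefficient
`1`. -/
theorem coeff_lehmerCode_schubert (w : Equiv.Perm (Fin n)) :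
    coeff (Finsupp.equivFunOnFinite.symm (lehmerCode w)) (schubert w) = 1 := by
  induction hN : Fintype.card (Fin n × Fin n) - (noninversions w).card
    using Nat.strong_induction_on generalizing w with
  | _ N ih =>
  subst hN
  by_cases h0 : ∀ i, lehmerCode w i = 0
  · rw [schubert_of_antitone w fun i j _ => by rw [h0, h0], coeff_monomial, if_pos rfl]
  have hne : (Finset.univ.filter fun i => lehmerCode w i ≠ 0).Nonempty := by
    push Not at h0
    obtain ⟨i, hi⟩ := h0
    exact ⟨i, by simpa using hi⟩
  -- The last nonzero entry of the code marks the last descent `a` of `w`; the induction removes it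
  -- by passing to `u = w s_a`.
  obtain ⟨a, ha, hmax⟩ := Finset.exists_max_image _ id hne
  have ha0 : lehmerCode w a ≠ 0 := (Finset.mem_filter.mp ha).2
  have hzero : ∀ j, a < j → lehmerCode w j = 0 := by
    intro j hj
    by_contra hc
    exact absurd (hmax j (Finset.mem_filter.mpr ⟨Finset.mem_univ _, hc⟩)) (not_le.mpr hj)
  have hbn : (a : ℕ) + 1 < n := by have := lehmerCode_add_le w a; omega
  obtain ⟨b, hab⟩ : ∃ b : Fin n, (a : ℕ) + 1 = b := ⟨⟨_, hbn⟩, rfl⟩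
  have hlt : a < b := Fin.lt_def.mpr (by omega)
  have hne : a ≠ b := hlt.ne
  have hb0 := hzero b hlt
  have hwab : w b < w a := by
    by_contra! hc
    have := lehmerCode_le_of_lt w hab (lt_of_le_of_ne hc fun e => hne (w.injective e))
    omega
  have hasc : ∀ c d : Fin n, (c : ℕ) + 1 = d → b ≤ c → w c < w d := by
    intro c d hcd hbc
    have hlt' : c < d := Fin.lt_def.mpr (by omega)
    by_contra! hc
    have := lehmerCode_lt_of_lt w hlt' (lt_of_le_of_ne hc fun e => hlt'.ne' (w.injective e))
    have := hzero c (hlt.trans_le hbc)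
    omega
  obtain ⟨u, hu⟩ : ∃ u, u = w * Equiv.swap a b := ⟨_, rfl⟩
  have hwu : w = u * Equiv.swap a b := by rw [hu, mul_assoc, Equiv.swap_mul_self, mul_one]
  have huab : u a < u b := by simpa [hu] using hwab
  have hcard := card_noninversions_mul_swap_lt u hab huab
  rw [← hwu] at hcard
  have hle := Finset.card_le_univ (noninversions u)
  have hcu := ih _ (by omega) u rfl
  have ca := lehmerCode_mul_swap_left u hab huab
  have cb := lehmerCode_mul_swap_right u hab huab
  have cj := fun j (h1 : j ≠ a) (h2 : j ≠ b) => lehmerCode_mul_swap_of_ne u hab h1 h2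
  rw [← hwu] at ca cb cj
  -- The code of `u` vanishes at `a`, so `coeff_divDiff` applies. Its second term has `x_b` in the
  -- exponent, and `x_b` does not occur in `𝔖_w`; the first term is the coefficient of the code
  -- monomial of `w`.
  rw [schubert_eq_divDiff u hab huab, ← hwu, coeff_divDiff hne _ (by simp [← cb, hb0]),
    coeff_schubert_eq_zero w b hasc (_ + _) (by simp), sub_zero] at hcu
  rw [← hcu]
  congr 1
  ext j
  simp only [Finsupp.mapDomain_equiv_apply, Equiv.symm_swap, Finsupp.add_apply,
    Finsupp.equivFunOnFinite_symm_apply_apply]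
  by_cases h1 : j = a
  · simp [h1, ca]
  · by_cases h2 : j = b
    · simp [h2, cb, hne.symm]
    · rw [Equiv.swap_apply_of_ne_of_ne h1 h2, cj j h1 h2, Finsupp.single_eq_of_ne h2, add_zero]

theorem antitone_of_succ_le {f : Fin n → ℕ}
    (h : ∀ a b : Fin n, (a : ℕ) + 1 = b → f b ≤ f a) : Antitone f := by
  have key : ∀ (d : ℕ) (a b : Fin n), (a : ℕ) + d = b → f b ≤ f a := by
    intro d
    induction d with
    | zero => intro a b hab; rw [Fin.ext hab]
    | succ d ih =>
      intro a b hab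
      have hc : (a : ℕ) + d < n := by have := b.2; omega
      exact (h ⟨_, hc⟩ b (by simp only; omega)).trans (ih a ⟨_, hc⟩ rfl)
  intro a b hab
  exact key (b - a) a b (by rw [Fin.le_def] at hab; omega)

theorem antitone_lehmerCode_of_isMonomial (w : Equiv.Perm (Fin n))
    (h : IsMonomial (schubert w)) : Antitone (lehmerCode w) := by
  obtain ⟨m, hm⟩ := h
  have h1 := coeff_lehmerCode_schubert w
  apply antitone_of_succ_le
  intro a b hab
  by_contra! hlt
  have hab' : a < b := Fin.lt_def.mpr (by omega)
  have hw : w a < w b := by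
    by_contra! hc
    exact absurd (lehmerCode_lt_of_lt w hab' (lt_of_le_of_ne hc fun e =>
      hab'.ne' (w.injective e))) hlt.asymm
  -- The code monomial and its image under the swap both have coefficient `1`, so both equal the
  -- single monomial `m`, contradicting `hlt`.
  have h2 := coeff_schubert_mapDomain_swap w hab hw
    (Finsupp.equivFunOnFinite.symm (lehmerCode w))
  rw [h1] at h2
  rw [hm, coeff_monomial] at h1 h2
  simp only [ite_eq_left_iff, zero_ne_one, imp_false, not_not] at h1 h2
  have := DFunLike.congr_fun (h1.symm.trans h2) a
  simp at this
  omega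

end Single

end Schubert

theorem proposition4p3 {n : ℕ} (w : Equiv.Perm (Fin n)) :
    (Schubert.IsDominant w ↔ ∃ μ : YoungDiagram, μ.cells = Schubert.diagram w) ∧
    (Schubert.IsDominant w ↔ Schubert.IsMonomial (Schubert.schubert w)) ∧
    (Schubert.IsDominant w ↔ Schubert.IsBinomialProduct (Schubert.doubleSchubert w)) := by
  rw [Schubert.isDominant_iff_antitone_lehmerCode]
  refine ⟨?_, ⟨fun h => ⟨_, Schubert.schubert_of_antitone w h⟩,
    Schubert.antitone_lehmerCode_of_isMonomial w⟩, Schubert.isBinomialProduct_of_antitone w,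
    fun h => Schubert.antitone_lehmerCode_of_isMonomial w
      (Schubert.isMonomial_of_isBinomialProduct w h)⟩
  rw [Schubert.antitone_lehmerCode_iff_isLowerSet]
  constructor
  · intro h
    exact ⟨⟨Schubert.diagram w, h⟩, rfl⟩
  · rintro ⟨μ, hμ⟩
    rw [← hμ]
    exact μ.isLowerSet
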